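/- Setting. Let $q$ be a prime power and measure entropies in base $q$. Write $\binom{b}{a}=0$ for $a>b$ and $[b]=\{1,\dots,b\}$. An exact-repair regenerating code with system parameters $(n,k,d)$ and code parameters $(\alpha,\beta,F_s)$ consists of random variables $S$ (the message), $N_i$ for $i\in[n]$ (the content of node $i$) and $R_{h\to f}$ for $h\ne f$ in $[n]$ (the repair data sent from $h$ to $f$), with $H(S)=F_s$ and $H(N_i)\le\alpha$, such that $H(S\mid N_i: i\in K)=0$ for every $K\subseteq[n]$ with $|K|=k$ (data recovery), and $H(R_{h\to f}\mid N_h)=0$, $H(R_{h\to f})\le\beta$ and $H(N_f\mid R_{h\to f}:h\in\mathcal H)=0$ for every $f$ and every $\mathcal H\subseteq[n]\setminus\{f\}$ with $|\mathcal H|=d$ (exact node repair). It is an $(n,k,d,\ell)$ Type-I secure code if moreover $I(S;(N_i)_{i\in L})=0$ for every $L\subseteq[n]$ with $|L|\le\ell$. Construction. Let $0\le\ell\le d<n$, let $\mathbb F_q$ be any finite field with $q>n$, let $x_1,\dots,x_n$ be distinct nonzero elements of $\mathbb F_q$, and let $m\in[d]$. For $I\subseteq[d]$ and $y\in[d]$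 put $\mathrm{ind}_I(y)=|\{z\in I:z\le y\}|$. The message matrix $M$ has rows labelled by $x\in[d]$ and columns labelled by the $m$-subsets $I$ of $[d]$. The entries $M(x,I)$ with $x\le\max I$ are independent and uniform on $\mathbb F_q$; those in the top $\ell$ rows ($x\le\ell$) are random keys, the others are the symbols of the message $S$. If $x>\max I$, then $M(x,I)=(-1)^m\sum_{y\in I}(-1)^{\mathrm{ind}_I(y)}M(y,(I\cup\{x\})\setminus\{y\})$. With $\Psi=(x_i^{\,j-1})_{i\in[n],\,j\in[d]}$, the content $N_i$ of node $i$ is the $i$-th row of $\Psi M$, and $R_{h\to f}=N_h\,\Xi^f$, where $\Xi^f$ has rows labelled by the $m$-subsets $I$ and columns labelled by the $(m-1)$-subsets $J$ of $[d]$, $\Xi^f(I,J)=(-1)^{\mathrm{ind}_I(y)}\Psi(f,y)$ if $I=J\cup\{y\}$ with $y\notin J$, and $\Xi^f(I,J)=0$ if $J\not\subseteq I$. Theorem. Let $0\le\ell\le d<n$ and let $\mathbb F_q$ be any finite field with $q>n$. Then $\mathbb F_q$ contains $n$ distinct nonzero elements, and for every choice of such elements $x_1,\dots,x_n$ the following holds.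 (1) For every mode $m\in[d]$ the code above is an $(n,k=d,d,\ell)$ Type-I secure code with parameters $$\alpha^{(m)}=\binom dm,\qquad \beta^{(m)}=\binom{d-1}{m-1},\qquad F_{s}^{(m)}=(d-\ell)\binom dm-\binom d{m+1}+\binom\ell{m+1}.$$ Moreover $\operatorname{rank}\Xi^f=\binom{d-1}{m-1}$ for every node $f$; for every list $e$ of $d$ distinct nodes, $M=\Psi_e^{-1}(\Psi M)_e$, where the subscript $e$ selects the rows in $e$; and for every node $f$ and every list $e$ of $d$ distinct nodes other than $f$, the entry of $N_f$ labelled $I$ equals $\sum_{y\in I}(-1)^{\mathrm{ind}_I(y)}R^f(y,I\setminus\{y\})$, where $R^f=\Psi_e^{-1}A$ and $A$ is the matrix whose rows are the $R_{h\to f}$ with $h$ in $e$. (2) (Memory sharing.) For all nonnegative integers $c_1,\dots,c_d$, using $c_m$ independent copies of the code of mode $m$ side by side, for all $m\in[d]$, gives an $(n,d,d,\ell)$ Type-I secure code with parameters $\sum_{m=1}^d c_m\,(\alpha^{(m)},\beta^{(m)},F_s^{(m)})$. Finally, (3) every tuple $(\alpha,\beta,F)$ in the convex hull of $\{(\alpha^{(m)},\beta^{(m)},F_s^{(m)}):m\in[d]\}$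 is achievable over $\mathbb F_q$: for every $\varepsilon>0$ there are an integer $T\ge1$ and an $(n,d,d,\ell)$ Type-I secure code, linear over $\mathbb F_q$, with parameters $(\alpha',\beta',F')$ satisfying $\alpha'\le T(\alpha+\varepsilon)$, $\beta'\le T(\beta+\varepsilon)$ and $F'\ge T(F-\varepsilon)$. -/

import Mathlib

noncomputable section

namespace SecureDSS

section Entropy

variable {Ω A B : Type*} [Fintype A] [Fintype B]

/-- Shannon entropy, in base `q`, of the finite-valued random variable `X` under `P`. -/
def entropy (q : ℕ) (P : PMF Ω) (X : Ω → A) : ℝ :=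
  (∑ a, Real.negMulLog ((P.map X) a).toReal) / Real.log q

/-- Conditional entropy `H(X | Y) = H(X, Y) - H(Y)`. -/
def condEntropy (q : ℕ) (P : PMF Ω) (X : Ω → A) (Y : Ω → B) : ℝ :=
  entropy q P (fun ω => (X ω, Y ω)) - entropy q P Y

/-- Mutual information `I(X; Y) = H(X) - H(X | Y)`. -/
def mutualInfo (q : ℕ) (P : PMF Ω) (X : Ω → A) (Y : Ω → B) : ℝ :=
  entropy q P X - condEntropy q P X Y

end Entropy

section Codes

/-- `S` (the message), `N i` (the content of node `i`) and `R h f` (the repair data sent by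
helper `h` to the failed node `f`) form an exact-repair regenerating code with system
parameters `(n, k, d)` and code parameters `(α, β, Fs)`, entropies being taken in base `q`. -/
structure IsExactRepairCode (q k d : ℕ) {n : ℕ} {Ω A B C : Type*}
    [Fintype A] [Fintype B] [Fintype C] (P : PMF Ω) (S : Ω → A) (N : Fin n → Ω → B)
    (R : Fin n → Fin n → Ω → C) (α β Fs : ℝ) : Prop where
  message_size : entropy q P S = Fs
  node_size : ∀ i, entropy q P (N i) ≤ α
  data_recovery : ∀ K : Finset (Fin n), K.card = k →
    condEntropy q P S (fun ω (i : K) => N i ω) = 0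
  repair_encoding : ∀ h f, h ≠ f → condEntropy q P (R h f) (N h) = 0
  repair_size : ∀ h f, h ≠ f → entropy q P (R h f) ≤ β
  node_repair : ∀ (f : Fin n) (H : Finset (Fin n)), f ∉ H → H.card = d →
    condEntropy q P (N f) (fun ω (h : H) => R h f ω) = 0

/-- An exact-repair regenerating code that leaks nothing about the message to an eavesdropper
who reads the contents of at most `ℓ` nodes. -/
structure IsTypeISecureCode (q k d ℓ : ℕ) {n : ℕ} {Ω A B C : Type*}
    [Fintype A] [Fintype B] [Fintype C] (P : PMF Ω) (S : Ω → A) (N : Fin n → Ω → B)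
    (R : Fin n → Fin n → Ω → C) (α β Fs : ℝ) : Prop
    extends IsExactRepairCode q k d P S N R α β Fs where
  secure : ∀ L : Finset (Fin n), L.card ≤ ℓ →
    mutualInfo q P S (fun ω (i : L) => N i ω) = 0

/-- A storage scheme for `n` nodes with `F`-linear encoding and repair maps. The message symbols
are indexed by `Msg`, the random keys by `Key`, the symbols stored in one node by `Col` and the
repair symbols sent by one helper by `Rep`. -/
structure LinearCode (F : Type*) [Field F] (n : ℕ) (Msg Key Col Rep : Type) where
  /-- the content of a node as a function of the message and the keys -/
  content : Fin n → ((Msg → F) × (Key → F)) →ₗ[F] (Col → F)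
  /-- `repairData h f` computes the data sent by `h` to `f` from the content of `h` -/
  repairData : Fin n → Fin n → (Col → F) →ₗ[F] (Rep → F)

variable {F : Type*} [Field F] [Fintype F] {n : ℕ}

/-- The scheme, used with message symbols and keys that are independent and uniform on `F`, is an
`(n, k, d, ℓ)` Type-I secure code with parameters `p = (α, β, Fs)`, in units of symbols of `F`. -/
def LinearCode.IsTypeISecure {Msg Key Col Rep : Type} [Fintype Msg] [DecidableEq Msg]
    [Fintype Key] [DecidableEq Key] [Fintype Col] [DecidableEq Col]
    [Fintype Rep] [DecidableEq Rep] (C : LinearCode F n Msg Key Col Rep)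
    (k d ℓ : ℕ) (p : ℝ × ℝ × ℝ) : Prop :=
  IsTypeISecureCode (Fintype.card F) k d ℓ
    (PMF.uniformOfFintype ((Msg → F) × (Key → F)))
    (fun ω => ω.1)
    (fun i ω => C.content i ω)
    (fun h f ω => C.repairData h f (C.content h ω))
    p.1 p.2.1 p.2.2

/-- Memory sharing: the schemes `C j` are used side by side, on separate messages and keys. -/
def LinearCode.juxtapose {J : Type} {Msg Key Col Rep : J → Type}
    (C : ∀ j, LinearCode F n (Msg j) (Key j) (Col j) (Rep j)) :
    LinearCode F n (Σ j, Msg j) (Σ j, Key j) (Σ j, Col j) (Σ j, Rep j) where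
  content i := LinearMap.pi fun c =>
    LinearMap.proj c.2 ∘ₗ (C c.1).content i ∘ₗ
      (LinearMap.funLeft F F (Sigma.mk c.1)).prodMap (LinearMap.funLeft F F (Sigma.mk c.1))
  repairData h f := LinearMap.pi fun r =>
    LinearMap.proj r.2 ∘ₗ (C r.1).repairData h f ∘ₗ LinearMap.funLeft F F (Sigma.mk r.1)

/-- The tuple `p = (α, β, Fs)` is achievable over `F`: up to an arbitrarily small loss per unit,
some multiple of it is attained by an `(n, k, d, ℓ)` Type-I secure linear code over `F`. -/
def Achievable (F : Type*) [Field F] [Fintype F] (n k d ℓ : ℕ) (p : ℝ × ℝ × ℝ) : Prop :=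
  ∀ ε : ℝ, 0 < ε → ∃ T : ℕ, 0 < T ∧
    ∃ (Msg Key Col Rep : Type) (_ : Fintype Msg) (_ : DecidableEq Msg)
      (_ : Fintype Key) (_ : DecidableEq Key) (_ : Fintype Col) (_ : DecidableEq Col)
      (_ : Fintype Rep) (_ : DecidableEq Rep)
      (C : LinearCode F n Msg Key Col Rep) (α β Fs : ℝ),
      C.IsTypeISecure k d ℓ (α, β, Fs) ∧
      α ≤ T * (p.1 + ε) ∧ β ≤ T * (p.2.1 + ε) ∧ T * (p.2.2 - ε) ≤ Fs

end Codes

section DeterminantCode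

/-- The subsets of `[d]` with `m` elements. -/
abbrev MSet (d m : ℕ) : Type := {I : Finset (Fin d) // I.card = m}

/-- `ind I x` is the number of elements of `I` that are at most `x`. -/
def ind {d : ℕ} (I : Finset (Fin d)) (x : Fin d) : ℕ := (I.filter (· ≤ x)).card

/-- Positions of type `𝒱`: the row label lies in the column label. -/
abbrev IsV {d : ℕ} (x : Fin d) (I : Finset (Fin d)) : Prop := x ∈ I

/-- Positions of type `𝒲`: the row label is outside the column label, below its maximum. -/
abbrev IsW {d : ℕ} (x : Fin d) (I : Finset (Fin d)) : Prop := x ∉ I ∧ ∃ y ∈ I, x < y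

/-- Positions of the secure file symbols: types `𝒱` and `𝒲`, below the top `ℓ` rows.
Rows are numbered from `0`. -/
abbrev FilePos (d ℓ m : ℕ) : Type :=
  {p : Fin d × MSet d m // (IsV p.1 p.2.1 ∨ IsW p.1 p.2.1) ∧ ℓ ≤ (p.1 : ℕ)}

/-- Positions of the random keys: types `𝒱` and `𝒲`, in the top `ℓ` rows. -/
abbrev KeyPos (d ℓ m : ℕ) : Type :=
  {p : Fin d × MSet d m // (IsV p.1 p.2.1 ∨ IsW p.1 p.2.1) ∧ (p.1 : ℕ) < ℓ}

variable (F : Type*) [Field F] {n : ℕ} (d ℓ m : ℕ)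

/-- The file symbol or key at a position of type `𝒱` or `𝒲` (and `0` elsewhere). -/
def infoEntry (x : Fin d) (I : Finset (Fin d)) :
    ((FilePos d ℓ m → F) × (KeyPos d ℓ m → F)) →ₗ[F] F :=
  if h : I.card = m ∧ (IsV x I ∨ IsW x I) then
    if hx : (x : ℕ) < ℓ then
      LinearMap.proj (⟨(x, ⟨I, h.1⟩), h.2, hx⟩ : KeyPos d ℓ m) ∘ₗ LinearMap.snd F _ _
    else
      LinearMap.proj (⟨(x, ⟨I, h.1⟩), h.2, not_lt.mp hx⟩ : FilePos d ℓ m) ∘ₗ LinearMap.fst F _ _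
  else 0

/-- An entry of the message matrix: a file symbol or key at a position of type `𝒱` or `𝒲`, and
the parity symbol at any other position. -/
def messageEntry (x : Fin d) (I : Finset (Fin d)) :
    ((FilePos d ℓ m → F) × (KeyPos d ℓ m → F)) →ₗ[F] F :=
  if IsV x I ∨ IsW x I then infoEntry F d ℓ m x I
  else (-1 : F) ^ m • ∑ y ∈ I, (-1 : F) ^ ind I y • infoEntry F d ℓ m y ((insert x I).erase y)

/-- The message matrix, with rows labelled by `[d]` and columns by the `m`-subsets of `[d]`. -/
def messageMatrix (ω : (FilePos d ℓ m → F) × (KeyPos d ℓ m → F)) :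
    Matrix (Fin d) (MSet d m) F :=
  Matrix.of fun x I => messageEntry F d ℓ m x I.1 ω

variable {F}

/-- The `n × d` Vandermonde encoder matrix with evaluation points `x`. -/
def encoder (x : Fin n → F) : Matrix (Fin n) (Fin d) F :=
  Matrix.of fun i j => x i ^ (j : ℕ)

/-- The repair encoder matrix of node `f`. The sum has at most one nonzero term, as at most one
element can be added to `J` to obtain `I`. -/
def repairEncoder (x : Fin n → F) (f : Fin n) : Matrix (MSet d m) (MSet d (m - 1)) F :=
  Matrix.of fun I J =>
    ∑ y : Fin d, if y ∉ J.1 ∧ insert y J.1 = I.1 then (-1 : F) ^ ind I.1 y * encoder d x f y else 0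

/-- The secure determinant code of mode `m`: node `i` stores the `i`-th row of the product of the
encoder matrix and the message matrix, and helpers multiply their contents by the repair encoder
matrix of the failed node. -/
def determinantCode (x : Fin n → F) :
    LinearCode F n (FilePos d ℓ m) (KeyPos d ℓ m) (MSet d m) (MSet d (m - 1)) where
  content i :=
    { toFun := fun ω => (encoder d x * messageMatrix F d ℓ m ω) i
      map_add' := by
        intro a b
        ext I
        simp [messageMatrix, Matrix.mul_apply, mul_add, Finset.sum_add_distrib]
      map_smul' := by
        intro c a
        ext I
        simp [messageMatrix, Matrix.mul_apply, Finset.mul_sum, mul_left_comm] }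
  repairData _ f := (repairEncoder d m x f).vecMulLinear

/-- The reconstruction of a matrix with `d` rows from the `d` rows that the nodes `e 0, e 1, …`
provide of its product with the encoder matrix. -/
def decodeRows (x : Fin n → F) (e : Fin d ↪ Fin n) {Col : Type*} (rows : Fin d → Col → F) :
    Matrix (Fin d) Col F :=
  ((encoder d x).submatrix e id)⁻¹ * Matrix.of rows

/-- The column label `I \ {y}`. -/
def MSet.erase {d m : ℕ} (I : MSet d m) (y : I.1) : MSet d (m - 1) :=
  ⟨I.1.erase y, by rw [Finset.card_erase_of_mem y.2, I.2]⟩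

/-- The repair decoder: the content of a failed node computed from the repair data sent by the
helpers `e 0, e 1, …`. -/
def decodeNode (x : Fin n → F) (e : Fin d ↪ Fin n) (data : Fin d → MSet d (m - 1) → F) :
    MSet d m → F :=
  fun I => ∑ y : I.1, (-1 : F) ^ ind I.1 y * decodeRows d x e data y (I.erase y)

/-- The tuple `(α, β, Fs)` of mode `m`. -/
def cornerPoint (d ℓ m : ℕ) : ℝ × ℝ × ℝ :=
  ((d.choose m : ℝ), ((d - 1).choose (m - 1) : ℝ),
    ((d : ℝ) - ℓ) * d.choose m - d.choose (m + 1) + ℓ.choose (m + 1))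

end DeterminantCode

end SecureDSS

end

/-! ### Entropies of linear functions of a uniform vector -/

namespace SecureDSS

/-- The entropy of a linear image of a uniform vector is its rank. -/
theorem entropy_linearMap {F Ω V : Type*} [Field F] [Fintype F] [AddCommGroup Ω] [Module F Ω]
    [Fintype Ω] [AddCommGroup V] [Module F V] [Fintype V] [Nonempty Ω] (A : Ω →ₗ[F] V) :
    entropy (Fintype.card F) (PMF.uniformOfFintype Ω) A =
      Module.finrank F (LinearMap.range A) := by
  classical
  set p := (PMF.uniformOfFintype Ω).map A with hp
  have hval : ∀ a, (p a).toReal =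
      ((Finset.univ.filter fun ω => A ω = a).card : ℝ) * (Fintype.card Ω : ℝ)⁻¹ := by
    intro a
    rw [hp, PMF.map_apply, tsum_fintype]
    simp only [PMF.uniformOfFintype_apply, ← Finset.sum_filter, Finset.sum_const, nsmul_eq_mul,
      ENNReal.toReal_mul, ENNReal.toReal_natCast, ENNReal.toReal_inv]
    simp only [eq_comm]
  -- Nonempty fibres are cosets of the kernel, so the image distribution is uniform on the range.
  have hconst : ∀ a ∈ LinearMap.range A, (p a).toReal = (p 0).toReal := by
    intro a ha
    rw [hval, hval]
    congr 2
    exact AddMonoidHom.card_fiber_eq_of_mem_range A.toAddMonoidHom ha ⟨0, map_zero A⟩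
  have hzero : ∀ a, a ∉ LinearMap.range A → (p a).toReal = 0 := by
    intro a ha
    rw [hval, Finset.filter_false_of_mem]
    · simp
    · intro ω _ h
      exact ha ⟨ω, h⟩
  have hsum : ∑ a, (p a).toReal = 1 := by
    have h := p.tsum_coe
    rw [tsum_fintype] at h
    rw [← ENNReal.toReal_sum (fun a _ => p.apply_ne_top a), h, ENNReal.toReal_one]
  set R := Finset.univ.filter fun a => a ∈ LinearMap.range A with hR
  have hRsum : ∀ g : V → ℝ, (∀ a, a ∉ LinearMap.range A → g a = 0) →
      (∀ a ∈ LinearMap.range A, g a = g 0) → ∑ a, g a = R.card * g 0 := by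
    intro g h0 h1
    rw [← Finset.sum_subset (Finset.subset_univ R), Finset.sum_congr rfl, Finset.sum_const,
      nsmul_eq_mul]
    · intro a ha
      exact h1 a (Finset.mem_filter.mp ha).2
    · intro a _ ha
      exact h0 a (by simpa [hR] using ha)
  have hcard : R.card = Fintype.card F ^ Module.finrank F (LinearMap.range A) := by
    rw [← Module.card_eq_pow_finrank (K := F) (V := LinearMap.range A), Fintype.card_subtype]
  rw [hRsum _ hzero hconst] at hsum
  have hlog : Real.log (Fintype.card F) ≠ 0 := by
    have := Fintype.one_lt_card (α := F)
    exact (Real.log_pos (by exact_mod_cast this)).ne'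
  rw [entropy, hRsum]
  · have hp0 : (p 0).toReal = (R.card : ℝ)⁻¹ := eq_inv_of_mul_eq_one_right hsum
    have hne : (R.card : ℝ) ≠ 0 := left_ne_zero_of_mul (hsum.trans_ne one_ne_zero)
    rw [← hp, hp0, Real.negMulLog, Real.log_inv, neg_mul_neg, ← mul_assoc, mul_inv_cancel₀ hne,
      one_mul, hcard]
    push_cast
    rw [Real.log_pow, mul_div_assoc, div_self hlog, mul_one]
  · intro a ha
    rw [← hp, hzero a ha, Real.negMulLog_zero]
  · intro a ha
    rw [← hp, hconst a ha]

section Linear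

variable {F Ω V W : Type*} [Field F] [Fintype F] [AddCommGroup Ω] [Module F Ω]
  [Fintype Ω] [AddCommGroup V] [Module F V] [Fintype V] [AddCommGroup W] [Module F W] [Fintype W]
  [Nonempty Ω]

omit [Fintype F] [Fintype V] [Nonempty Ω] in
theorem finrank_range_eq_sub_ker (A : Ω →ₗ[F] V) : (Module.finrank F (LinearMap.range A) : ℝ) =
    Module.finrank F Ω - Module.finrank F (LinearMap.ker A) := by
  have := A.finrank_range_add_finrank_ker
  rw [← this]
  push_cast
  ring

/-- A linear function of a uniform vector that vanishes wherever another one does is determined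
by it. -/
theorem condEntropy_eq_zero_of_ker_le (A : Ω →ₗ[F] V) (B : Ω →ₗ[F] W)
    (h : ∀ ω, B ω = 0 → A ω = 0) :
    condEntropy (Fintype.card F) (PMF.uniformOfFintype Ω) A B = 0 := by
  have h1 := entropy_linearMap (A.prod B)
  have h2 : LinearMap.ker (A.prod B) = LinearMap.ker B := by
    rw [LinearMap.ker_prod]
    exact inf_eq_right.mpr fun ω hω => h ω hω
  rw [condEntropy, entropy_linearMap B]
  change entropy _ _ (A.prod B) - _ = 0
  rw [h1, finrank_range_eq_sub_ker, finrank_range_eq_sub_ker, h2, sub_self]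

/-- The uniform message `s` is independent of a linear function of `(s, k)` if the kernel of
that function projects onto the messages. -/
theorem mutualInfo_eq_zero_of_ker_surjective {V₁ V₂ : Type*} [AddCommGroup V₁] [Module F V₁]
    [Fintype V₁] [AddCommGroup V₂] [Module F V₂] [Fintype V₂] (B : V₁ × V₂ →ₗ[F] W)
    (h : ∀ s, ∃ k, B (s, k) = 0) :
    mutualInfo (Fintype.card F) (PMF.uniformOfFintype (V₁ × V₂)) (fun ω => ω.1) B = 0 := by
  have h1 := entropy_linearMap ((LinearMap.fst F V₁ V₂).prod B)
  have h2 := entropy_linearMap (LinearMap.fst F V₁ V₂)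
  have h3 := entropy_linearMap B
  -- Restricting the first projection to the kernel of `B` gives a surjection whose kernel has the
  -- dimension of the kernel of the pair. Rank–nullity then makes the rank of the pair the sum of
  -- the two ranks.
  have hsurj : LinearMap.range ((LinearMap.fst F V₁ V₂).domRestrict (LinearMap.ker B)) = ⊤ := by
    rw [LinearMap.range_eq_top]
    intro s
    obtain ⟨k, hk⟩ := h s
    exact ⟨⟨(s, k), hk⟩, rfl⟩
  have hker : Module.finrank F (LinearMap.ker ((LinearMap.fst F V₁ V₂).prod B)) =
      Module.finrank F
        (LinearMap.ker ((LinearMap.fst F V₁ V₂).domRestrict (LinearMap.ker B))) := by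
    rw [LinearMap.ker_prod, LinearMap.ker_domRestrict]
    exact ((Submodule.comapSubtypeEquivOfLe inf_le_right).finrank_eq.symm.trans
      (by rw [Submodule.comap_inf, Submodule.comap_subtype_self, inf_top_eq]))
  have hfst := ((LinearMap.fst F V₁ V₂).domRestrict (LinearMap.ker B)).finrank_range_add_finrank_ker
  rw [hsurj, finrank_top] at hfst
  have hB := B.finrank_range_add_finrank_ker
  have hP := ((LinearMap.fst F V₁ V₂).prod B).finrank_range_add_finrank_ker
  have hF : LinearMap.range (LinearMap.fst F V₁ V₂) = ⊤ :=
    LinearMap.range_eq_top.2 Prod.fst_surjective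
  rw [hF, finrank_top] at h2
  change entropy _ _ (LinearMap.fst F V₁ V₂) -
    (entropy _ _ ((LinearMap.fst F V₁ V₂).prod B) - entropy _ _ B) = 0
  rw [h1, h2, h3]
  have hfin : (Module.finrank F (LinearMap.range ((LinearMap.fst F V₁ V₂).prod B)) : ℤ) =
      Module.finrank F V₁ + Module.finrank F (LinearMap.range B) := by
    omega
  have : (Module.finrank F (LinearMap.range ((LinearMap.fst F V₁ V₂).prod B)) : ℝ) =
      Module.finrank F V₁ + Module.finrank F (LinearMap.range B) := by exact_mod_cast hfin
  rw [this]
  ring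

end Linear

/-! ### Secure codes as conditions on kernels -/

/-- The linear-algebraic form of the axioms of a Type-I secure code. The size of the repair data
is bounded by the size of a set of coordinates that determine it. -/
structure LinearCode.IsLinearSecure {F : Type*} [Field F] {n : ℕ} {Msg Key Col Rep : Type}
    (C : LinearCode F n Msg Key Col Rep) (k d ℓ β : ℕ) : Prop where
  data_recovery : ∀ K : Finset (Fin n), K.card = k → ∀ ω, (∀ i ∈ K, C.content i ω = 0) → ω.1 = 0
  repair_size : ∀ h f, ∃ B : Finset Rep, B.card = β ∧
    ∀ v, (∀ b ∈ B, C.repairData h f v b = 0) → C.repairData h f v = 0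
  node_repair : ∀ (f : Fin n) (H : Finset (Fin n)), f ∉ H → H.card = d →
    ∀ ω, (∀ h ∈ H, C.repairData h f (C.content h ω) = 0) → C.content f ω = 0
  secure : ∀ L : Finset (Fin n), L.card ≤ ℓ → ∀ s, ∃ t, ∀ i ∈ L, C.content i (s, t) = 0

theorem LinearCode.IsLinearSecure.isTypeISecure {F : Type*} [Field F] [Fintype F] {n : ℕ}
    {Msg Key Col Rep : Type} [Fintype Msg] [DecidableEq Msg]
    [Fintype Key] [DecidableEq Key] [Fintype Col] [DecidableEq Col]
    [Fintype Rep] [DecidableEq Rep] {C : LinearCode F n Msg Key Col Rep} {k d ℓ β : ℕ}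
    (hC : C.IsLinearSecure k d ℓ β) :
    C.IsTypeISecure k d ℓ ((Fintype.card Col : ℝ), (β : ℝ), (Fintype.card Msg : ℝ)) := by
  refine ⟨⟨?_, ?_, ?_, ?_, ?_, ?_⟩, ?_⟩
  · have h := entropy_linearMap (LinearMap.fst F (Msg → F) (Key → F))
    rw [LinearMap.range_eq_top.2 Prod.fst_surjective, finrank_top, Module.finrank_fintype_fun_eq_card] at h
    exact h
  · intro i
    refine (entropy_linearMap (C.content i)).trans_le ?_
    have := Submodule.finrank_le (LinearMap.range (C.content i))
    rw [Module.finrank_fintype_fun_eq_card] at this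
    exact Nat.cast_le.2 this
  · intro K hK
    exact condEntropy_eq_zero_of_ker_le (LinearMap.fst F (Msg → F) (Key → F))
      (LinearMap.pi fun i : K => C.content i)
      fun ω hω => hC.data_recovery K hK ω fun i hi => congrFun hω ⟨i, hi⟩
  · intro h f _
    exact condEntropy_eq_zero_of_ker_le (C.repairData h f ∘ₗ C.content h) (C.content h)
      fun ω hω => by rw [LinearMap.comp_apply, hω, map_zero]
  · intro h f _
    refine (entropy_linearMap (C.repairData h f ∘ₗ C.content h)).trans_le ?_
    obtain ⟨B, hB, hv⟩ := hC.repair_size h f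
    -- The coordinates in `B` separate the points of the range, so its dimension is at most `β`.
    have hinj : Function.Injective ((LinearMap.funLeft F F ((↑) : B → Rep)).domRestrict
        (LinearMap.range (C.repairData h f ∘ₗ C.content h))) := by
      rw [injective_iff_map_eq_zero]
      rintro ⟨_, ω, rfl⟩ h0
      exact Subtype.ext (hv _ fun b hb => congrFun h0 ⟨b, hb⟩)
    have := LinearMap.finrank_le_finrank_of_injective hinj
    rw [Module.finrank_fintype_fun_eq_card, Fintype.card_coe, hB] at this
    exact Nat.cast_le.2 this
  · intro f H hf hH
    exact condEntropy_eq_zero_of_ker_le (C.content f)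
      (LinearMap.pi fun h : H => C.repairData h f ∘ₗ C.content h)
      fun ω hω => hC.node_repair f H hf hH ω fun h hh => congrFun hω ⟨h, hh⟩
  · intro L hL
    refine mutualInfo_eq_zero_of_ker_surjective (LinearMap.pi fun i : L => C.content i) fun s => ?_
    obtain ⟨t, ht⟩ := hC.secure L hL s
    exact ⟨t, funext fun i => ht i i.2⟩

/-- Memory sharing preserves the linear-algebraic axioms. -/
theorem LinearCode.IsLinearSecure.juxtapose {F : Type*} [Field F] {n : ℕ} {J : Type} [Fintype J]
    {Msg Key Col Rep : J → Type} {C : ∀ j, LinearCode F n (Msg j) (Key j) (Col j) (Rep j)}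
    {k d ℓ : ℕ} {β : J → ℕ} (hC : ∀ j, (C j).IsLinearSecure k d ℓ (β j)) :
    (LinearCode.juxtapose C).IsLinearSecure k d ℓ (∑ j, β j) := by
  have hcont : ∀ i ω, (LinearCode.juxtapose C).content i ω = 0 ↔
      ∀ j, (C j).content i (fun a => ω.1 ⟨j, a⟩, fun a => ω.2 ⟨j, a⟩) = 0 := fun i ω =>
    ⟨fun h j => funext fun c => congrFun h ⟨j, c⟩, fun h => funext fun c => congrFun (h c.1) c.2⟩
  have hrep : ∀ h f v, (LinearCode.juxtapose C).repairData h f v = 0 ↔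
      ∀ j, (C j).repairData h f (fun a => v ⟨j, a⟩) = 0 := fun i f v =>
    ⟨fun h j => funext fun c => congrFun h ⟨j, c⟩, fun h => funext fun c => congrFun (h c.1) c.2⟩
  refine ⟨fun K hK ω hω => ?_, fun h f => ?_, fun f H hf hH ω hω => ?_, fun L hL s => ?_⟩
  · funext a
    exact congrFun ((hC a.1).data_recovery K hK _ fun i hi => (hcont i ω).1 (hω i hi) a.1) a.2
  · choose B hB hv using fun j => (hC j).repair_size h f
    refine ⟨Finset.univ.sigma B, by simp [Finset.card_sigma, hB], fun v h0 => (hrep _ _ _).2 ?_⟩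
    exact fun j => hv j _ fun b hb => h0 ⟨j, b⟩ (by simpa using hb)
  · refine (hcont _ _).2 fun j => (hC j).node_repair f H hf hH _ fun h hh => ?_
    exact (hrep _ _ _).1 (hω h hh) j
  · choose t ht using fun j => (hC j).secure L hL fun a => s ⟨j, a⟩
    exact ⟨fun a => t a.1 a.2, fun i hi => (hcont _ _).2 fun j => ht j i hi⟩

end SecureDSS

/-! ### Contraction of alternating forms and parity sums -/

namespace SecureDSS

section Contraction

variable {F : Type*} [Field F] {d : ℕ}

/-- Contraction of a form, given by its coefficients at all subsets of `[d]`, with a vector. -/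
def contract (ψ : Fin d → F) (g : Finset (Fin d) → F) (J : Finset (Fin d)) : F :=
  ∑ z ∈ Jᶜ, (-1 : F) ^ ind (insert z J) z * ψ z * g (insert z J)

/-- The alternating sum, over the elements `y` of `J`, of the entries of `M` at `(y, J \ {y})`:
up to sign, the image of `M` in the exterior power. -/
def paritySum (M : Fin d → Finset (Fin d) → F) (J : Finset (Fin d)) : F :=
  ∑ y ∈ J, (-1 : F) ^ ind J y * M y (J.erase y)

theorem ind_insert {K : Finset (Fin d)} {y z : Fin d} (hz : z ∉ K) :
    ind (insert z K) y = ind K y + if z ≤ y then 1 else 0 := by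
  unfold ind
  rw [Finset.filter_insert]
  split_ifs
  · rw [Finset.card_insert_of_notMem fun h => hz (Finset.mem_filter.1 h).1]
  · rfl

theorem sign_mul_self (k : ℕ) : (-1 : F) ^ k * (-1 : F) ^ k = 1 := by
  rw [← mul_pow, neg_one_mul, neg_neg, one_pow]

/-- Exactly one of `y ≤ z` and `z ≤ y` holds, so exactly one of the two signs changes when the other
element is present. This is the anticommutation behind both contraction identities. -/
theorem sign_insert_insert {K : Finset (Fin d)} {y z : Fin d} (hy : y ∉ K) (hz : z ∉ K)
    (hyz : y ≠ z) :
    (-1 : F) ^ ind (insert z (insert y K)) z * (-1 : F) ^ ind (insert z (insert y K)) y =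
      -((-1 : F) ^ ind (insert y K) y * (-1 : F) ^ ind (insert z K) z) := by
  have h1 : ind (insert z (insert y K)) z = ind (insert z K) z + if y ≤ z then 1 else 0 := by
    rw [Finset.insert_comm, ind_insert (by simp [hy, hyz])]
  have h2 : ind (insert z (insert y K)) y = ind (insert y K) y + if z ≤ y then 1 else 0 :=
    ind_insert (by simp [hz, hyz.symm])
  rw [h1, h2]
  rcases lt_or_gt_of_ne hyz with h | h
  · rw [if_pos h.le, if_neg h.not_ge]
    ring
  · rw [if_neg h.not_ge, if_pos h.le]
    ring

theorem sign_erase_insert {J : Finset (Fin d)} {y z : Fin d} (hy : y ∈ J) (hz : z ∉ J) :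
    (-1 : F) ^ ind (insert z J) z * (-1 : F) ^ ind (insert z J) y =
      -((-1 : F) ^ ind J y * (-1 : F) ^ ind (insert z (J.erase y)) z) := by
  have h := sign_insert_insert (F := F) (Finset.notMem_erase y J)
    (fun h => hz (Finset.mem_of_mem_erase h) : z ∉ J.erase y) (fun h => hz (h ▸ hy))
  rwa [Finset.insert_erase hy] at h

theorem insert_erase_comm {J : Finset (Fin d)} {y z : Fin d} (hy : y ∈ J) (hz : z ∉ J) :
    insert z (J.erase y) = (insert z J).erase y :=
  (Finset.erase_insert_of_ne fun h : z = y => hz (h ▸ hy)).symm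

/-- Cartan's formula relating contraction and the passage to the exterior power. -/
theorem contract_paritySum (ψ : Fin d → F) (M : Fin d → Finset (Fin d) → F)
    (J : Finset (Fin d)) :
    contract ψ (paritySum M) J + paritySum (fun y => contract ψ (M y)) J = ∑ y, ψ y * M y J := by
  -- In either order of the operations, the terms where the removed element is the added one give
  -- the rows outside, respectively inside, `J`. The remaining mixed terms agree up to sign and
  -- cancel.
  have h1 : contract ψ (paritySum M) J = ∑ z ∈ Jᶜ, ψ z * M z J +
      ∑ z ∈ Jᶜ, ∑ y ∈ J, (-1 : F) ^ ind (insert z J) z * (-1 : F) ^ ind (insert z J) y *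
        (ψ z * M y ((insert z J).erase y)) := by
    rw [← Finset.sum_add_distrib]
    refine Finset.sum_congr rfl fun z hz => ?_
    have hz := Finset.mem_compl.1 hz
    rw [paritySum, Finset.sum_insert hz, mul_add, Finset.mul_sum, Finset.erase_insert hz]
    congr 1
    · linear_combination (ψ z * M z J) * sign_mul_self (F := F) (ind (insert z J) z)
    · exact Finset.sum_congr rfl fun y _ => by ring
  have h2 : paritySum (fun y => contract ψ (M y)) J = ∑ y ∈ J, ψ y * M y J -
      ∑ y ∈ J, ∑ z ∈ Jᶜ, (-1 : F) ^ ind (insert z J) z * (-1 : F) ^ ind (insert z J) y *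
        (ψ z * M y ((insert z J).erase y)) := by
    rw [← Finset.sum_sub_distrib]
    refine Finset.sum_congr rfl fun y hy => ?_
    change _ * contract ψ (M y) (J.erase y) = _
    rw [contract, Finset.compl_erase, Finset.sum_insert (by simpa using hy),
      Finset.insert_erase hy, mul_add, sub_eq_add_neg, Finset.mul_sum, ← Finset.sum_neg_distrib]
    congr 1
    · linear_combination (ψ y * M y J) * sign_mul_self (F := F) (ind J y)
    · refine Finset.sum_congr rfl fun z hz => ?_
      have hz := Finset.mem_compl.1 hz
      rw [sign_erase_insert hy hz, insert_erase_comm hy hz]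
      ring
  rw [h1, h2, Finset.sum_comm, ← Finset.sum_add_sum_compl J]
  ring

/-- The diagonal is treated separately because antisymmetry does not make it vanish in
characteristic 2. -/
theorem sum_sum_eq_zero_of_antisymm {ι : Type*} [Fintype ι] [DecidableEq ι] (f : ι → ι → F)
    (h0 : ∀ i, f i i = 0) (h : ∀ i j, i ≠ j → f i j + f j i = 0) : ∑ i, ∑ j, f i j = 0 := by
  rw [← Fintype.sum_prod_type']
  refine Finset.sum_involution (fun p _ => p.swap) ?_ ?_ (fun _ _ => Finset.mem_univ _)
    fun _ _ => Prod.swap_swap _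
  · rintro ⟨i, j⟩ _
    by_cases hij : i = j
    · subst hij
      simp [h0]
    · exact h i j hij
  · rintro ⟨i, j⟩ _ hne heq
    obtain rfl : j = i := congrArg Prod.fst heq
    exact hne (h0 _)

/-- The two orders of adding a pair of elements carry opposite signs, so the sum over ordered pairs
cancels under the swap. -/
theorem contract_contract (ψ : Fin d → F) (g : Finset (Fin d) → F) (J : Finset (Fin d)) :
    contract ψ (contract ψ g) J = 0 := by
  have h : contract ψ (contract ψ g) J = ∑ z, ∑ w, if z ∉ J ∧ w ∉ J ∧ z ≠ w then
      (-1 : F) ^ ind (insert z J) z * (-1 : F) ^ ind (insert w (insert z J)) w *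
        (ψ z * ψ w * g (insert w (insert z J))) else 0 := by
    unfold contract
    rw [← Finset.sum_subset (Finset.subset_univ Jᶜ)]
    · refine Finset.sum_congr rfl fun z hz => ?_
      have hz := Finset.mem_compl.1 hz
      rw [Finset.mul_sum, ← Finset.sum_subset (Finset.subset_univ (insert z J)ᶜ)]
      · refine Finset.sum_congr rfl fun w hw => ?_
        simp only [Finset.mem_compl, Finset.mem_insert, not_or] at hw
        rw [if_pos ⟨hz, hw.2, Ne.symm hw.1⟩]
        ring
      · intro w _ hw
        rw [if_neg]
        rintro ⟨_, h1, h2⟩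
        simp only [Finset.mem_compl, Finset.mem_insert, not_not] at hw
        exact hw.elim (fun h => h2 h.symm) h1
    · intro z _ hz
      refine Finset.sum_eq_zero fun w _ => if_neg fun h => hz (Finset.mem_compl.2 h.1)
  rw [h]
  refine sum_sum_eq_zero_of_antisymm _ (fun z => if_neg fun h => h.2.2 rfl) fun z w hzw => ?_
  by_cases hz : z ∈ J
  · simp [hz]
  by_cases hw : w ∈ J
  · simp [hw]
  rw [if_pos ⟨hz, hw, hzw⟩, if_pos ⟨hw, hz, hzw.symm⟩, Finset.insert_comm z w J]
  have h1 := sign_insert_insert (F := F) hz hw hzw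
  have h2 := sign_mul_self (F := F) (ind (insert w (insert z J)) w)
  have h3 := sign_mul_self (F := F) (ind (insert w (insert z J)) z)
  have h4 := sign_mul_self (F := F) (ind (insert w J) w)
  have h5 := sign_mul_self (F := F) (ind (insert z J) z)
  set a := (-1 : F) ^ ind (insert w (insert z J)) w
  set b := (-1 : F) ^ ind (insert w (insert z J)) z
  set c := (-1 : F) ^ ind (insert z J) z
  set e := (-1 : F) ^ ind (insert w J) w
  have hac : c * a + e * b = 0 := by
    linear_combination (b * c) * h1 - (a * c) * h3 - b * e * h5
  linear_combination (ψ z * ψ w * g (insert w (insert z J))) * hac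

/-- If the rows of `M` are annihilated by `ℓ` vectors in echelon form, then the parity sums that
involve only the first `ℓ` rows follow from the other ones. -/
theorem paritySum_eq_zero_of_echelon {ℓ : ℕ} (p : Fin d → Fin d → F)
    (hp : ∀ a y : Fin d, (a : ℕ) < ℓ → (y : ℕ) < ℓ → p a y = if y = a then 1 else 0) (k : ℕ) :
    ∀ M : Fin d → Finset (Fin d) → F,
      (∀ a : Fin d, (a : ℕ) < ℓ → ∀ I, ∑ y, p a y * M y I = 0) →
      (∀ J : Finset (Fin d), (∃ y ∈ J, ℓ ≤ (y : ℕ)) → paritySum M J = 0) →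
      ∀ J : Finset (Fin d), J.card = k → paritySum M J = 0 := by
  induction k with
  | zero =>
    intro M _ _ J hJ
    rw [Finset.card_eq_zero.1 hJ]
    exact Finset.sum_empty
  | succ k ih =>
    intro M hM hT J hJ
    by_cases hbot : ∃ y ∈ J, ℓ ≤ (y : ℕ)
    · exact hT J hbot
    push Not at hbot
    -- Cartan's formula with right-hand side zero: contracting the rows with `p a` commutes with the
    -- parity sum up to sign. The contracted matrix therefore inherits both hypotheses, which is why
    -- `M` varies in the induction.
    have hcartan : ∀ a : Fin d, (a : ℕ) < ℓ → ∀ K,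
        paritySum (fun y => contract (p a) (M y)) K = -contract (p a) (paritySum M) K := by
      intro a ha K
      have h := contract_paritySum (p a) M K
      rw [hM a ha K] at h
      linear_combination h
    obtain ⟨a, ha⟩ : J.Nonempty := Finset.card_pos.1 (by omega)
    have hal := hbot a ha
    have hzero := ih (fun y => contract (p a) (M y)) (fun b hb I => by
        simp only [contract, Finset.mul_sum]
        rw [Finset.sum_comm]
        refine Finset.sum_eq_zero fun z _ => ?_
        rw [← mul_zero ((-1 : F) ^ ind (insert z I) z * p a z), ← hM b hb (insert z I),
          Finset.mul_sum]
        exact Finset.sum_congr rfl fun y _ => by ring)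
      (fun K hK => by
        rw [hcartan a hal, neg_eq_zero]
        refine Finset.sum_eq_zero fun z _ => ?_
        obtain ⟨y, hy, hyl⟩ := hK
        rw [hT _ ⟨y, Finset.mem_insert_of_mem hy, hyl⟩, mul_zero])
      (J.erase a) (by rw [Finset.card_erase_of_mem ha, hJ, Nat.add_sub_cancel])
    -- Only `z = a` survives: at other top indices the echelon form gives `p a z = 0`, and a bottom
    -- index makes the parity sum vanish by hypothesis.
    rw [hcartan a hal, neg_eq_zero, contract, Finset.sum_eq_single a] at hzero
    · rw [Finset.insert_erase ha, hp a a hal hal, if_pos rfl, mul_one] at hzero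
      exact (mul_eq_zero.1 hzero).resolve_left (pow_ne_zero _ (neg_ne_zero.2 one_ne_zero))
    · intro z _ hza
      rcases lt_or_ge (z : ℕ) ℓ with hz | hz
      · rw [hp a z hal hz, if_neg hza, mul_zero, zero_mul]
      · rw [hT _ ⟨z, Finset.mem_insert_self _ _, hz⟩, mul_zero]
    · intro h
      exact absurd (Finset.mem_compl.2 (Finset.notMem_erase a J)) h

end Contraction

end SecureDSS

/-! ### The message matrix and its parity relations -/

namespace SecureDSS

section DeterminantCodes

variable {F : Type*} [Field F] {n d ℓ m : ℕ}

theorem not_isV_or_isW_iff {x : Fin d} {I : Finset (Fin d)} :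
    ¬(IsV x I ∨ IsW x I) ↔ ∀ y ∈ I, y < x := by
  constructor
  · intro h y hy
    rw [not_or] at h
    refine lt_of_le_of_ne (not_lt.1 fun hxy => h.2 ⟨h.1, y, hy, hxy⟩) fun hyx => h.1 ?_
    exact hyx ▸ hy
  · rintro h (hx | ⟨_, y, hy, hxy⟩)
    · exact lt_irrefl x (h x hx)
    · exact lt_asymm hxy (h y hy)

theorem isW_erase_insert {x y : Fin d} {I : Finset (Fin d)} (h : ∀ y ∈ I, y < x) (hy : y ∈ I) :
    IsW y ((insert x I).erase y) :=
  ⟨Finset.notMem_erase _ _, x,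
    Finset.mem_erase.2 ⟨(h y hy).ne', Finset.mem_insert_self _ _⟩, h y hy⟩

theorem exists_eq_insert_max {J : Finset (Fin d)} (hJ : J.Nonempty) :
    ∃ x I, (∀ y ∈ I, y < x) ∧ J = insert x I :=
  ⟨J.max' hJ, J.erase (J.max' hJ), fun _ hy => J.lt_max'_of_mem_erase_max' hJ hy,
    (Finset.insert_erase (J.max'_mem hJ)).symm⟩

/-- Since `x` exceeds all of `I`, its sign depends only on the size of `I`, and adding it leaves the
other signs unchanged. The relation can thus be solved for the entry at the parity position `(x,
I)`. -/
theorem paritySum_insert_of_lt (M : Fin d → Finset (Fin d) → F) {x : Fin d} {I : Finset (Fin d)}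
    (h : ∀ y ∈ I, y < x) : paritySum M (insert x I) = (-1 : F) ^ (I.card + 1) * M x I +
      ∑ y ∈ I, (-1 : F) ^ ind I y * M y ((insert x I).erase y) := by
  have hx : x ∉ I := fun hx => lt_irrefl x (h x hx)
  rw [paritySum, Finset.sum_insert hx, Finset.erase_insert hx, ind_insert hx, if_pos le_rfl]
  congr 1
  · rw [ind, Finset.filter_true_of_mem fun y hy => (h y hy).le]
  · refine Finset.sum_congr rfl fun y hy => ?_
    rw [ind_insert hx, if_neg (h y hy).not_ge, add_zero]

theorem infoEntry_of_card_ne {x : Fin d} {I : Finset (Fin d)} (hI : I.card ≠ m) :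
    infoEntry F d ℓ m x I = 0 :=
  dif_neg fun h => hI h.1

theorem card_erase_insert {x y : Fin d} {I : Finset (Fin d)} (hx : x ∉ I) (hy : y ∈ I) :
    ((insert x I).erase y).card = I.card := by
  rw [Finset.card_erase_of_mem (Finset.mem_insert_of_mem hy), Finset.card_insert_of_notMem hx,
    Nat.add_sub_cancel]

/-- The defining property of the message matrix. -/
theorem paritySum_messageEntry (ω : (FilePos d ℓ m → F) × (KeyPos d ℓ m → F))
    (J : Finset (Fin d)) : paritySum (fun x I => messageEntry F d ℓ m x I ω) J = 0 := by
  rcases J.eq_empty_or_nonempty with rfl | hJ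
  · exact Finset.sum_empty
  obtain ⟨x, I, h, rfl⟩ := exists_eq_insert_max hJ
  have hx : x ∉ I := fun hx => lt_irrefl x (h x hx)
  have hsum : ∑ y ∈ I, (-1 : F) ^ ind I y * messageEntry F d ℓ m y ((insert x I).erase y) ω =
      ∑ y ∈ I, (-1 : F) ^ ind I y * infoEntry F d ℓ m y ((insert x I).erase y) ω :=
    Finset.sum_congr rfl fun y hy => by
      rw [messageEntry, if_pos (Or.inr (isW_erase_insert h hy))]
  rw [paritySum_insert_of_lt _ h, hsum, messageEntry, if_neg (not_isV_or_isW_iff.2 h)]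
  simp only [LinearMap.smul_apply, LinearMap.sum_apply, smul_eq_mul]
  -- Column labels of the wrong size carry only the default value zero, so the relation holds for
  -- sets `J` of every size.
  by_cases hI : I.card = m
  · rw [hI]
    linear_combination (-∑ y ∈ I, (-1 : F) ^ ind I y *
      infoEntry F d ℓ m y ((insert x I).erase y) ω) * sign_mul_self (F := F) m
  · have h0 : ∀ y ∈ I, (-1 : F) ^ ind I y * infoEntry F d ℓ m y ((insert x I).erase y) ω = 0 :=
      fun y hy => by
        rw [infoEntry_of_card_ne (by rwa [card_erase_insert hx hy]), LinearMap.zero_apply, mul_zero]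
    rw [Finset.sum_eq_zero h0, mul_zero, mul_zero, add_zero]

/-- The message matrix is determined by the entries of types `𝒱` and `𝒲`. -/
theorem messageEntry_eq_of_paritySum (M : Fin d → Finset (Fin d) → F)
    (hM : ∀ J, paritySum M J = 0) (ω : (FilePos d ℓ m → F) × (KeyPos d ℓ m → F))
    (hω : ∀ x I, I.card = m → (IsV x I ∨ IsW x I) → infoEntry F d ℓ m x I ω = M x I)
    (x : Fin d) (I : Finset (Fin d)) (hI : I.card = m) : messageEntry F d ℓ m x I ω = M x I := by
  rw [messageEntry]
  split_ifs with h
  · exact hω x I hI h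
  rw [not_isV_or_isW_iff] at h
  have hx : x ∉ I := fun hx => lt_irrefl x (h x hx)
  have h1 := hM (insert x I)
  rw [paritySum_insert_of_lt M h, hI] at h1
  simp only [LinearMap.smul_apply, LinearMap.sum_apply, smul_eq_mul]
  rw [Finset.sum_congr rfl fun y hy => by
    rw [hω y _ ((card_erase_insert hx hy).trans hI) (Or.inr (isW_erase_insert h hy))]]
  linear_combination (-1 : F) ^ m * h1 + M x I * sign_mul_self (F := F) m

theorem fst_eq_zero_of_messageMatrix_eq_zero {ω : (FilePos d ℓ m → F) × (KeyPos d ℓ m → F)}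
    (h : messageMatrix F d ℓ m ω = 0) : ω.1 = 0 := by
  funext p
  have h1 : messageEntry F d ℓ m p.1.1 p.1.2.1 ω = 0 := congrFun (congrFun h p.1.1) p.1.2
  rw [messageEntry, if_pos p.2.1, infoEntry, dif_pos ⟨p.1.2.2, p.2.1⟩,
    dif_neg (not_lt.2 p.2.2)] at h1
  exact h1

/-! ### Completing a matrix under the eavesdropper's equations -/

/-- Matrices with vanishing parity sums and rows annihilated by `ℓ` vectors in echelon form can
have arbitrary entries of types `𝒱` and `𝒲` below the first `ℓ` rows. -/
theorem exists_paritySum_eq_zero_of_echelon (p : Fin d → Fin d → F)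
    (hp : ∀ a y : Fin d, (a : ℕ) < ℓ → (y : ℕ) < ℓ → p a y = if y = a then 1 else 0)
    (s : Fin d → Finset (Fin d) → F) :
    ∃ M : Fin d → Finset (Fin d) → F,
      (∀ a : Fin d, (a : ℕ) < ℓ → ∀ I, ∑ y, p a y * M y I = 0) ∧
      (∀ J, paritySum M J = 0) ∧
      ∀ (x : Fin d) I, ℓ ≤ (x : ℕ) → (IsV x I ∨ IsW x I) → M x I = s x I := by
  let bottom (N : Fin d → Finset (Fin d) → F) (x : Fin d) (I : Finset (Fin d)) : F :=
    if ℓ ≤ (x : ℕ) then N x I else 0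
  -- The top rows are recomputed from the bottom ones so that the vectors `p a` annihilate the
  -- result.
  let lift (N : Fin d → Finset (Fin d) → F) (x : Fin d) (I : Finset (Fin d)) : F :=
    bottom N x I - if (x : ℕ) < ℓ then ∑ y, p x y * bottom N y I else 0
  have hbottom : ∀ N N' c x I, bottom (c • N + N') x I = c * bottom N x I + bottom N' x I := by
    intro N N' c x I
    simp only [bottom]
    split_ifs <;> simp
  have hlift : ∀ N N' c x I, lift (c • N + N') x I = c * lift N x I + lift N' x I := by
    intro N N' c x I
    simp only [lift, hbottom]
    split_ifs
    · simp only [mul_add, Finset.sum_add_distrib, mul_left_comm _ c, ← Finset.mul_sum]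
      ring
    · ring
  have hpar : ∀ N N' c J, paritySum (lift (c • N + N')) J =
      c * paritySum (lift N) J + paritySum (lift N') J := by
    intro N N' c J
    simp only [paritySum, hlift, mul_add, Finset.sum_add_distrib, mul_left_comm _ c,
      ← Finset.mul_sum]
  have hlift_bot : ∀ N (x : Fin d) I, ℓ ≤ (x : ℕ) → lift N x I = N x I := by
    intro N x I hx
    simp only [lift, bottom]
    rw [if_pos hx, if_neg hx.not_gt, sub_zero]
  -- At a bottom parity position `θ` records the parity relation to be met, elsewhere the entry
  -- itself. Having equal source and target, it is surjective once injective.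
  let θ : (Fin d → Finset (Fin d) → F) →ₗ[F] (Fin d → Finset (Fin d) → F) :=
    IsLinearMap.mk' (fun N x I =>
      if ℓ ≤ (x : ℕ) ∧ ∀ y ∈ I, y < x then paritySum (lift N) (insert x I) else N x I)
      { map_add := fun N N' => by
          funext x I
          have := hpar N N' 1 (insert x I)
          rw [one_smul, one_mul] at this
          simp only [this, Pi.add_apply]
          split_ifs <;> rfl
        map_smul := fun c N => by
          funext x I
          have h0 := hpar 0 0 1 (insert x I)
          have := hpar N 0 c (insert x I)
          rw [one_smul, add_zero, one_mul, left_eq_add] at h0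
          rw [add_zero, h0, add_zero] at this
          simp only [this, Pi.smul_apply, smul_eq_mul]
          split_ifs <;> rfl }
  have hθ : ∀ N x I, θ N x I =
    if ℓ ≤ (x : ℕ) ∧ ∀ y ∈ I, y < x then paritySum (lift N) (insert x I) else N x I :=
    fun _ _ _ => rfl
  have hinj : Function.Injective θ := by
    rw [injective_iff_map_eq_zero]
    intro N hN
    have hz : ∀ x I, θ N x I = 0 := fun x I => by rw [hN]; rfl
    have hz0 : ∀ (x : Fin d) I, (IsV x I ∨ IsW x I) → N x I = 0 := by
      intro x I hx
      have h := hz x I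
      rwa [hθ, if_neg fun h' => not_isV_or_isW_iff.2 h'.2 hx] at h
    funext x
    -- Downward induction on the row shows triangularity. In the relation at `(x, I)` the other
    -- terms have column labels with maximum `x`; through the lift they involve only entries of
    -- types `𝒱` and `𝒲`, already zero, and parity entries in rows below `x`, that is with larger
    -- index.
    induction x using (wellFounded_gt (α := Fin d)).induction with
    | _ x ih =>
    funext I
    have h := hz x I
    rw [hθ] at h
    split_ifs at h with hx
    · rw [paritySum_insert_of_lt _ hx.2, Finset.sum_eq_zero, add_zero, hlift_bot N x I hx.1] at h
      · exact (mul_eq_zero.1 h).resolve_left (pow_ne_zero _ (neg_ne_zero.2 one_ne_zero))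
      intro y hy
      have hw := isW_erase_insert hx.2 hy
      rcases le_or_gt ℓ (y : ℕ) with hyl | hyl
      · rw [hlift_bot N y _ hyl, hz0 _ _ (Or.inr hw), mul_zero]
      · have : ∀ w, bottom N w ((insert x I).erase y) = 0 := by
          intro w
          simp only [bottom]
          split_ifs
          · by_cases hw' : IsV w ((insert x I).erase y) ∨ IsW w ((insert x I).erase y)
            · exact hz0 _ _ hw'
            · rw [not_isV_or_isW_iff] at hw'
              have hxw : x < w := hw' x (Finset.mem_erase.2
                ⟨(hx.2 y hy).ne', Finset.mem_insert_self _ _⟩)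
              exact congrFun (ih w hxw) _
          · rfl
        simp only [lift, this, mul_zero, Finset.sum_const_zero, ite_self, sub_zero]
    · exact h
  obtain ⟨N, hN⟩ := (LinearMap.injective_iff_surjective (f := θ)).1 hinj
    (fun x I => if ℓ ≤ (x : ℕ) ∧ ∀ y ∈ I, y < x then 0 else s x I)
  have hNx : ∀ (x : Fin d) I, (if ℓ ≤ (x : ℕ) ∧ ∀ y ∈ I, y < x then
      paritySum (lift N) (insert x I) else N x I) =
      if ℓ ≤ (x : ℕ) ∧ ∀ y ∈ I, y < x then 0 else s x I := fun x I => by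
    rw [← hθ, hN]
  have hrows : ∀ a : Fin d, (a : ℕ) < ℓ → ∀ I, ∑ y, p a y * lift N y I = 0 := by
    intro a ha I
    simp only [lift, mul_sub, Finset.sum_sub_distrib]
    rw [sub_eq_zero]
    symm
    rw [Finset.sum_eq_single a]
    · rw [hp a a ha ha, if_pos rfl, one_mul, if_pos ha]
    · intro y _ hya
      split_ifs with hy
      · rw [hp a y ha hy, if_neg hya, zero_mul]
      · rw [mul_zero]
    · exact fun h => absurd (Finset.mem_univ a) h
  refine ⟨lift N, hrows, fun J => ?_, fun x I hx h => ?_⟩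
  -- A set that meets the bottom rows has its maximum there, so its relation was imposed by `θ`.
  · refine paritySum_eq_zero_of_echelon p hp J.card (lift N) hrows ?_ J rfl
    rintro J ⟨y, hy, hyl⟩
    obtain ⟨x, I, h, rfl⟩ := exists_eq_insert_max ⟨y, hy⟩
    have hx : ℓ ≤ (x : ℕ) := by
      rcases Finset.mem_insert.1 hy with rfl | hy
      · exact hyl
      · exact hyl.trans (h y hy).le
    have h1 := hNx x I
    rwa [if_pos ⟨hx, h⟩, if_pos ⟨hx, h⟩] at h1
  · have h1 := hNx x I
    have h2 : ¬(ℓ ≤ (x : ℕ) ∧ ∀ y ∈ I, y < x) := fun h' => not_isV_or_isW_iff.2 h'.2 h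
    rw [if_neg h2, if_neg h2] at h1
    rw [hlift_bot N x I hx, h1]

/-! ### Decoding, repair and secrecy of the determinant code -/

theorem isUnit_det_vandermonde {k : ℕ} {x : Fin n → F} (hx : Function.Injective x)
    (e : Fin k ↪ Fin n) : IsUnit (Matrix.vandermonde (x ∘ e)).det :=
  (Matrix.det_vandermonde_ne_zero_iff.2 (hx.comp e.injective)).isUnit

theorem decodeRows_mul {x : Fin n → F} (hx : Function.Injective x) (e : Fin d ↪ Fin n)
    {Col : Type*} (B : Matrix (Fin d) Col F) :
    decodeRows d x e (fun a => (encoder d x * B) (e a)) = B := by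
  have h1 : (encoder d x).submatrix e id = Matrix.vandermonde (x ∘ e) := by
    ext a b
    simp [encoder, Matrix.vandermonde_apply]
  have h2 : (Matrix.of fun a => (encoder d x * B) (e a)) = Matrix.vandermonde (x ∘ e) * B := by
    rw [← h1]
    rfl
  rw [decodeRows, h1, h2, Matrix.nonsing_inv_mul_cancel_left _ _ (isUnit_det_vandermonde hx e)]

theorem determinantCode_content (x : Fin n → F) (i : Fin n)
    (ω : (FilePos d ℓ m → F) × (KeyPos d ℓ m → F)) (I : MSet d m) :
    (determinantCode d ℓ m x).content i ω I =
      ∑ y, encoder d x i y * messageEntry F d ℓ m y I.1 ω := rfl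

/-- Column `J` is supported on the sets `J ∪ {z}` with `z ∉ J`. The bound `1 ≤ m` ensures that these
have size `m` despite truncated subtraction. -/
theorem vecMul_repairEncoder (hm : 1 ≤ m) (x : Fin n → F) (f : Fin n)
    (g : Finset (Fin d) → F) (J : MSet d (m - 1)) :
    Matrix.vecMul (fun I : MSet d m => g I.1) (repairEncoder d m x f) J =
      contract (encoder d x f) g J.1 := by
  simp only [Matrix.vecMul, dotProduct, repairEncoder, Matrix.of_apply, Finset.mul_sum]
  rw [Finset.sum_comm, contract, ← Finset.sum_subset (Finset.subset_univ J.1ᶜ)]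
  · refine Finset.sum_congr rfl fun z hz => ?_
    have hz := Finset.mem_compl.1 hz
    have hcard : (insert z J.1).card = m := by
      rw [Finset.card_insert_of_notMem hz, J.2, Nat.sub_add_cancel hm]
    rw [Finset.sum_eq_single ⟨insert z J.1, hcard⟩]
    · rw [if_pos ⟨hz, rfl⟩]
      ring
    · intro I _ hI
      rw [if_neg fun h => hI (Subtype.ext h.2.symm), mul_zero]
    · exact fun h => absurd (Finset.mem_univ _) h
  · intro z _ hz
    refine Finset.sum_eq_zero fun I _ => ?_
    rw [if_neg fun h => hz (Finset.mem_compl.2 h.1), mul_zero]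

/-- Vandermonde inversion recovers the contracted rows of the message matrix. As its parity sums
vanish, Cartan's formula identifies their parity sum with the combination of rows stored by `f`. -/
theorem determinantCode_repair (hm : 1 ≤ m) {x : Fin n → F} (hx : Function.Injective x)
    (f : Fin n) (e : Fin d ↪ Fin n) (ω : (FilePos d ℓ m → F) × (KeyPos d ℓ m → F)) :
    decodeNode d m x e (fun a => (determinantCode d ℓ m x).repairData (e a) f
      ((determinantCode d ℓ m x).content (e a) ω)) = (determinantCode d ℓ m x).content f ω := by
  have hrows : decodeRows d x e (fun a => (determinantCode d ℓ m x).repairData (e a) f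
      ((determinantCode d ℓ m x).content (e a) ω)) =
      messageMatrix F d ℓ m ω * repairEncoder d m x f := by
    rw [← decodeRows_mul hx e (messageMatrix F d ℓ m ω * repairEncoder d m x f),
      ← Matrix.mul_assoc]
    rfl
  funext I
  have h1 : ∀ y (J : MSet d (m - 1)), (messageMatrix F d ℓ m ω * repairEncoder d m x f) y J =
      contract (encoder d x f) (fun I => messageEntry F d ℓ m y I ω) J.1 := fun y J =>
    vecMul_repairEncoder hm x f (fun I => messageEntry F d ℓ m y I ω) J
  have h2 := contract_paritySum (encoder d x f) (fun y I => messageEntry F d ℓ m y I ω) I.1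
  have h3 : contract (encoder d x f) (paritySum fun y I => messageEntry F d ℓ m y I ω) I.1 = 0 :=
    Finset.sum_eq_zero fun z _ => by rw [paritySum_messageEntry, mul_zero]
  rw [h3, zero_add] at h2
  rw [determinantCode_content, ← h2, decodeNode, hrows, paritySum]
  simp only [h1]
  exact Finset.sum_coe_sort I.1 fun y => (-1 : F) ^ ind I.1 y *
    contract (encoder d x f) (fun I => messageEntry F d ℓ m y I ω) (I.1.erase y)

theorem card_mSet (d m : ℕ) : Fintype.card (MSet d m) = d.choose m := by
  rw [Fintype.card_finset_len, Fintype.card_fin]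

theorem card_mSet_notMem (z : Fin d) :
    (Finset.univ.filter fun J : MSet d m => z ∉ J.1).card = (d - 1).choose m := by
  have h : (Finset.univ.filter fun J : MSet d m => z ∉ J.1).card =
      (Finset.powersetCard m (Finset.univ.erase z)).card := by
    refine Finset.card_bij (fun J _ => J.1) ?_ (fun _ _ _ _ h => Subtype.ext h) ?_
    · intro J hJ
      refine Finset.mem_powersetCard.2 ⟨fun y hy => Finset.mem_erase.2 ⟨?_, Finset.mem_univ _⟩, J.2⟩
      rintro rfl
      exact (Finset.mem_filter.1 hJ).2 hy
    · intro J hJ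
      rw [Finset.mem_powersetCard] at hJ
      exact ⟨⟨J, hJ.2⟩, Finset.mem_filter.2 ⟨Finset.mem_univ _,
        fun h => Finset.notMem_erase _ _ (hJ.1 h)⟩, rfl⟩
  rw [h, Finset.card_powersetCard, Finset.card_erase_of_mem (Finset.mem_univ z),
    Finset.card_univ, Fintype.card_fin]

/-- The repair data are determined by the symbols whose labels avoid the first row. -/
theorem vecMul_repairEncoder_eq_zero (hm : 1 ≤ m) (z : Fin d) (hz : (z : ℕ) = 0) (x : Fin n → F)
    (f : Fin n) (v : MSet d m → F)
    (h : ∀ J : MSet d (m - 1), z ∉ J.1 → Matrix.vecMul v (repairEncoder d m x f) J = 0) :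
    Matrix.vecMul v (repairEncoder d m x f) = 0 := by
  funext J
  by_cases hJ : z ∈ J.1
  swap
  · exact h J hJ
  let g : Finset (Fin d) → F := fun I => if hI : I.card = m then v ⟨I, hI⟩ else 0
  have hg : v = fun I : MSet d m => g I.1 := by
    funext I
    simp only [g]
    rw [dif_pos I.2]
  rw [hg] at h ⊢
  rw [vecMul_repairEncoder hm]
  -- The first encoder coordinate is `x f ^ 0 = 1`, so this relation solves for the symbol at `J` in
  -- terms of symbols whose labels avoid `z`.
  have h1 := contract_contract (encoder d x f) g (J.1.erase z)
  rw [contract, Finset.sum_eq_single z] at h1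
  · have h2 : encoder d x f z = 1 := by simp [encoder, hz]
    rw [h2, mul_one, Finset.insert_erase hJ] at h1
    exact (mul_eq_zero.1 h1).resolve_left (pow_ne_zero _ (neg_ne_zero.2 one_ne_zero))
  · intro w hw hwz
    have hw : w ∉ J.1.erase z := Finset.mem_compl.1 hw
    have hcard : (insert w (J.1.erase z)).card = m - 1 := by
      rw [Finset.card_insert_of_notMem hw, Finset.card_erase_of_mem hJ, J.2]
      have := Finset.card_pos.2 ⟨z, hJ⟩
      rw [J.2] at this
      omega
    have h3 := h ⟨_, hcard⟩ (by simp [hwz.symm])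
    rw [vecMul_repairEncoder hm] at h3
    rw [h3, mul_zero]
  · exact fun h => absurd (Finset.mem_compl.2 (Finset.notMem_erase z J.1)) h

theorem rank_repairEncoder (hm : 1 ≤ m) (hmd : m ≤ d) (x : Fin n → F) (f : Fin n) :
    (repairEncoder d m x f).rank = (d - 1).choose (m - 1) := by
  let z : Fin d := ⟨0, by omega⟩
  let B := Finset.univ.filter fun J : MSet d (m - 1) => z ∉ J.1
  let ρ : LinearMap.range (repairEncoder d m x f).vecMulLinear →ₗ[F] (B → F) :=
    (LinearMap.funLeft F F ((↑) : B → MSet d (m - 1))).domRestrict _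
  have hinj : Function.Injective ρ := by
    rw [injective_iff_map_eq_zero]
    rintro ⟨_, v, rfl⟩ h0
    refine Subtype.ext (vecMul_repairEncoder_eq_zero hm z rfl x f v fun J hJ => ?_)
    exact congrFun h0 ⟨J, Finset.mem_filter.2 ⟨Finset.mem_univ _, hJ⟩⟩
  have hsurj : Function.Surjective ρ := by
    intro r
    -- A form supported on labels containing `z` contributes only through adding `z` when `z ∉ J`.
    -- The minus sign cancels `(-1) ^ 1`, as `z` is the least index.
    let g : Finset (Fin d) → F := fun I =>
      if h : z ∈ I ∧ (I.erase z).card = m - 1 then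
        -r ⟨⟨I.erase z, h.2⟩, Finset.mem_filter.2 ⟨Finset.mem_univ _, Finset.notMem_erase _ _⟩⟩
      else 0
    refine ⟨⟨_, fun I : MSet d m => g I.1, rfl⟩, ?_⟩
    funext J
    have hJ : z ∉ J.1.1 := (Finset.mem_filter.1 J.2).2
    refine (vecMul_repairEncoder hm x f g J.1).trans ?_
    rw [contract, Finset.sum_eq_single z]
    · have h1 : ind (insert z J.1.1) z = 1 := by
        have : ((insert z J.1.1).filter (· ≤ z)) = {z} := by
          ext y
          simp only [Finset.mem_filter, Finset.mem_insert, Finset.mem_singleton]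
          constructor
          · rintro ⟨_, hy⟩
            exact le_antisymm hy (Fin.le_def.2 (Nat.zero_le _))
          · rintro rfl
            exact ⟨Or.inl rfl, le_rfl⟩
        rw [ind, this, Finset.card_singleton]
      have h2 : encoder d x f z = 1 := by simp [encoder, z]
      have h3 : g (insert z J.1.1) = -r J := by
        simp only [g]
        rw [dif_pos ⟨Finset.mem_insert_self _ _, by rw [Finset.erase_insert hJ, J.1.2]⟩]
        congr 2
        exact Subtype.ext (Subtype.ext (Finset.erase_insert hJ))
      rw [h1, h2, h3]
      ring
    · intro w _ hw
      have : g (insert w J.1.1) = 0 := dif_neg fun h =>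
        (Finset.mem_insert.1 h.1).elim (fun h => hw h.symm) hJ
      rw [this, mul_zero]
    · exact fun h => absurd (Finset.mem_compl.2 hJ) h
  rw [← Matrix.rank_transpose, Matrix.rank, ← Matrix.vecMulLinear_transpose,
    Matrix.transpose_transpose, (LinearEquiv.ofBijective ρ ⟨hinj, hsurj⟩).finrank_eq,
    Module.finrank_fintype_fun_eq_card, Fintype.card_coe, card_mSet_notMem]

theorem determinantCode_data_recovery {x : Fin n → F} (hx : Function.Injective x)
    (e : Fin d ↪ Fin n) (ω : (FilePos d ℓ m → F) × (KeyPos d ℓ m → F)) :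
    decodeRows d x e (fun a => (determinantCode d ℓ m x).content (e a) ω) =
      messageMatrix F d ℓ m ω :=
  decodeRows_mul hx e _

theorem exists_embedding_range_eq {k : ℕ} {K : Finset (Fin n)} (hK : K.card = k) :
    ∃ e : Fin k ↪ Fin n, Set.range e = K :=
  ⟨(K.orderEmbOfFin hK).toEmbedding, K.range_orderEmbOfFin hK⟩

theorem determinantCode_secure {x : Fin n → F} (hx : Function.Injective x) (hℓ : ℓ ≤ d)
    (e : Fin ℓ ↪ Fin n) (s : FilePos d ℓ m → F) :
    ∃ t, ∀ b, (determinantCode d ℓ m x).content (e b) (s, t) = 0 := by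
  have hdet := isUnit_det_vandermonde hx e
  let E : Matrix (Fin ℓ) (Fin d) F := (encoder d x).submatrix e id
  -- The first `ℓ` columns of `E` form a Vandermonde matrix; dividing by it puts the eavesdropped
  -- rows in echelon form without changing their span.
  let P : Matrix (Fin ℓ) (Fin d) F := (Matrix.vandermonde (x ∘ e))⁻¹ * E
  have hE : Matrix.vandermonde (x ∘ e) * P = E := Matrix.mul_nonsing_inv_cancel_left _ _ hdet
  let p : Fin d → Fin d → F := fun a y => if h : (a : ℕ) < ℓ then P ⟨a, h⟩ y else 0
  have hp : ∀ a y : Fin d, (a : ℕ) < ℓ → (y : ℕ) < ℓ → p a y = if y = a then 1 else 0 := by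
    intro a y ha hy
    have h1 : P ⟨a, ha⟩ y =
        ((Matrix.vandermonde (x ∘ e))⁻¹ * Matrix.vandermonde (x ∘ e)) ⟨a, ha⟩ ⟨y, hy⟩ := by
      simp only [P, Matrix.mul_apply]
      rfl
    simp only [p]
    rw [dif_pos ha, h1, Matrix.nonsing_inv_mul _ hdet, Matrix.one_apply]
    simp only [Fin.ext_iff, eq_comm]
  obtain ⟨M, hM, hpar, hs⟩ := exists_paritySum_eq_zero_of_echelon p hp fun y I =>
    if h : I.card = m ∧ (IsV y I ∨ IsW y I) ∧ ℓ ≤ (y : ℕ) then s ⟨(y, ⟨I, h.1⟩), h.2⟩ else 0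
  -- The keys are read off from the top rows of the completed matrix.
  refine ⟨fun k => M k.1.1 k.1.2.1, fun b => ?_⟩
  have hentry : ∀ y (I : MSet d m),
      messageEntry F d ℓ m y I.1 (s, fun k => M k.1.1 k.1.2.1) = M y I.1 := by
    intro y I
    refine messageEntry_eq_of_paritySum M hpar _ ?_ y I.1 I.2
    intro y I hI hy
    rw [infoEntry, dif_pos ⟨hI, hy⟩]
    split_ifs with hyl
    · rfl
    · rw [hs y I (not_lt.1 hyl) hy, dif_pos ⟨hI, hy, not_lt.1 hyl⟩]
      rfl
  funext I
  rw [determinantCode_content]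
  have h1 : ∀ y, encoder d x (e b) y = ∑ a, Matrix.vandermonde (x ∘ e) b a * P a y := fun y =>
    (congrFun (congrFun hE b) y).symm
  simp only [h1, hentry, Finset.sum_mul]
  rw [Finset.sum_comm]
  refine Finset.sum_eq_zero fun a _ => ?_
  have h2 := hM ⟨a, a.2.trans_le hℓ⟩ a.2 I.1
  simp only [p] at h2
  simp only [dif_pos a.2] at h2
  rw [← mul_zero (Matrix.vandermonde (x ∘ e) b a), ← h2, Finset.mul_sum]
  exact Finset.sum_congr rfl fun y _ => mul_assoc _ _ _

theorem determinantCode_isLinearSecure {x : Fin n → F} (hx : Function.Injective x) (hd : d < n)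
    (hℓ : ℓ ≤ d) (hm : 1 ≤ m) (hmd : m ≤ d) :
    (determinantCode d ℓ m x).IsLinearSecure d d ℓ ((d - 1).choose (m - 1)) := by
  refine ⟨fun K hK ω hω => ?_, fun h f => ?_, fun f H _ hH ω hω => ?_, fun L hL s => ?_⟩
  · obtain ⟨e, he⟩ := exists_embedding_range_eq hK
    refine fst_eq_zero_of_messageMatrix_eq_zero ?_
    rw [← determinantCode_data_recovery hx e]
    have : (fun a => (determinantCode d ℓ m x).content (e a) ω) = fun _ => 0 :=
      funext fun a => hω _ (Finset.mem_coe.1 (he ▸ Set.mem_range_self a))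
    rw [this, decodeRows]
    exact Matrix.mul_zero _
  · let z : Fin d := ⟨0, by omega⟩
    refine ⟨Finset.univ.filter fun J => z ∉ J.1, card_mSet_notMem z, fun v hv => ?_⟩
    exact vecMul_repairEncoder_eq_zero hm z rfl x f v fun J hJ =>
      hv J (Finset.mem_filter.2 ⟨Finset.mem_univ _, hJ⟩)
  · obtain ⟨e, he⟩ := exists_embedding_range_eq hH
    rw [← determinantCode_repair hm hx f e]
    have : (fun a => (determinantCode d ℓ m x).repairData (e a) f
        ((determinantCode d ℓ m x).content (e a) ω)) = fun _ => 0 :=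
      funext fun a => hω _ (Finset.mem_coe.1 (he ▸ Set.mem_range_self a))
    have h0 : decodeRows d x e (fun _ => (0 : MSet d (m - 1) → F)) = 0 := by
      rw [decodeRows]
      exact Matrix.mul_zero _
    rw [this]
    funext I
    simp only [decodeNode, h0, Matrix.zero_apply, mul_zero, Finset.sum_const_zero, Pi.zero_apply]
  -- Enlarging to exactly `ℓ` nodes, possible since `ℓ ≤ d < n`, only strengthens the claim.
  · obtain ⟨L', hLL', hL'⟩ := Finset.exists_superset_card_eq hL
      (by rw [Fintype.card_fin]; omega)
    obtain ⟨e, he⟩ := exists_embedding_range_eq hL'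
    obtain ⟨t, ht⟩ := determinantCode_secure hx hℓ e s
    refine ⟨t, fun i hi => ?_⟩
    obtain ⟨b, rfl⟩ : i ∈ Set.range e := he ▸ Finset.mem_coe.2 (hLL' hi)
    exact ht b

/-! ### Counting the file symbols -/

theorem card_fin_lt (hℓ : ℓ ≤ d) : (Finset.univ.filter fun y : Fin d => (y : ℕ) < ℓ).card = ℓ := by
  rw [Fin.card_filter_val_lt, min_eq_right hℓ]

/-- From all positions in the bottom rows one removes the parity positions. Joining row and column
labels matches these with the `(m + 1)`-sets whose maximum is at least `ℓ`, namely those not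
contained in the first `ℓ` indices. -/
theorem card_filePos (hℓ : ℓ ≤ d) (m : ℕ) : (Fintype.card (FilePos d ℓ m) : ℝ) =
    ((d : ℝ) - ℓ) * d.choose m - d.choose (m + 1) + ℓ.choose (m + 1) := by
  have hrows : (Finset.univ.filter fun y : Fin d => ℓ ≤ (y : ℕ)).card = d - ℓ := by
    have h := Finset.card_filter_add_card_filter_not (s := Finset.univ)
      (fun y : Fin d => (y : ℕ) < ℓ)
    simp only [not_lt, card_fin_lt hℓ, Finset.card_univ, Fintype.card_fin] at h
    omega
  let U : Finset (Fin d × MSet d m) :=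
    (Finset.univ.filter fun y : Fin d => ℓ ≤ (y : ℕ)) ×ˢ Finset.univ
  have hU : U.card = (d - ℓ) * d.choose m := by
    rw [Finset.card_product, hrows, Finset.card_univ, card_mSet]
  have hsplit := Finset.card_filter_add_card_filter_not (s := U)
    (fun p => IsV p.1 p.2.1 ∨ IsW p.1 p.2.1)
  have hfile : (U.filter fun p => IsV p.1 p.2.1 ∨ IsW p.1 p.2.1).card =
      Fintype.card (FilePos d ℓ m) := by
    rw [Fintype.card_subtype]
    congr 1
    ext p
    simp only [U, Finset.mem_filter, Finset.mem_product, Finset.mem_univ, true_and, and_true]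
    exact and_comm
  let V : Finset (Finset (Fin d)) := Finset.powersetCard (m + 1) Finset.univ
  have hparity : (U.filter fun p => ¬(IsV p.1 p.2.1 ∨ IsW p.1 p.2.1)).card =
      (V.filter fun J => ¬ J ⊆ Finset.univ.filter fun y : Fin d => (y : ℕ) < ℓ).card := by
    refine Finset.card_bij (fun p _ => insert p.1 p.2.1) ?_ ?_ ?_
    · rintro ⟨y, I⟩ hp
      rw [Finset.mem_filter, not_isV_or_isW_iff] at hp
      have hyl : ℓ ≤ (y : ℕ) := (Finset.mem_filter.1 (Finset.mem_product.1 hp.1).1).2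
      refine Finset.mem_filter.2 ⟨Finset.mem_powersetCard.2 ⟨Finset.subset_univ _, ?_⟩, fun h => ?_⟩
      · rw [Finset.card_insert_of_notMem fun h => lt_irrefl _ (hp.2 _ h), I.2]
      · exact (Finset.mem_filter.1 (h (Finset.mem_insert_self _ _))).2.not_ge hyl
    · rintro ⟨y, I⟩ hp ⟨y', I'⟩ hp' heq
      rw [Finset.mem_filter, not_isV_or_isW_iff] at hp hp'
      have heq : insert y I.1 = insert y' I'.1 := heq
      have hy : y = y' := by
        have h1 : y ∈ insert y' I'.1 := heq ▸ Finset.mem_insert_self _ _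
        have h2 : y' ∈ insert y I.1 := heq ▸ Finset.mem_insert_self _ _
        rcases Finset.mem_insert.1 h1 with h1 | h1
        · exact h1
        rcases Finset.mem_insert.1 h2 with h2 | h2
        · exact h2.symm
        · exact absurd (hp.2 _ h2) (hp'.2 _ h1).asymm
      subst hy
      have hI : I.1 = I'.1 := by
        rw [← Finset.erase_insert fun h => lt_irrefl _ (hp.2 _ h), heq,
          Finset.erase_insert fun h => lt_irrefl _ (hp'.2 _ h)]
      rw [Subtype.ext hI]
    · intro J hJ
      rw [Finset.mem_filter, Finset.mem_powersetCard] at hJ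
      obtain ⟨⟨_, hcard⟩, hnot⟩ := hJ
      obtain ⟨w, hw, hwl⟩ := Finset.not_subset.1 hnot
      obtain ⟨y, I, h, rfl⟩ := exists_eq_insert_max ⟨w, hw⟩
      have hI : I.card = m := by
        rw [Finset.card_insert_of_notMem fun h' => lt_irrefl _ (h _ h')] at hcard
        omega
      have hwl : ℓ ≤ (w : ℕ) := by simpa using hwl
      have hyl : ℓ ≤ (y : ℕ) := by
        rcases Finset.mem_insert.1 hw with rfl | hw
        · exact hwl
        · exact hwl.trans (h w hw).le
      refine ⟨(y, ⟨I, hI⟩), Finset.mem_filter.2 ⟨Finset.mem_product.2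
        ⟨Finset.mem_filter.2 ⟨Finset.mem_univ _, hyl⟩, Finset.mem_univ _⟩,
        not_isV_or_isW_iff.2 h⟩, rfl⟩
  have hsub := Finset.card_filter_add_card_filter_not (s := V)
    (fun J => J ⊆ Finset.univ.filter fun y : Fin d => (y : ℕ) < ℓ)
  have hV : V.card = d.choose (m + 1) := by
    rw [Finset.card_powersetCard, Finset.card_univ, Fintype.card_fin]
  have htop : (V.filter fun J => J ⊆ Finset.univ.filter fun y : Fin d => (y : ℕ) < ℓ).card =
      ℓ.choose (m + 1) := by
    have : (V.filter fun J => J ⊆ Finset.univ.filter fun y : Fin d => (y : ℕ) < ℓ) =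
        Finset.powersetCard (m + 1) (Finset.univ.filter fun y : Fin d => (y : ℕ) < ℓ) := by
      ext J
      simp only [V, Finset.mem_filter, Finset.mem_powersetCard, Finset.subset_univ, true_and]
      exact and_comm
    rw [this, Finset.card_powersetCard, card_fin_lt hℓ]
  rw [hfile, hU, hparity] at hsplit
  rw [hV, htop] at hsub
  have h1 := congrArg (Nat.cast (R := ℝ)) hsplit
  have h2 := congrArg (Nat.cast (R := ℝ)) hsub
  push_cast [Nat.cast_sub hℓ] at h1 h2
  linear_combination h1 - h2

end DeterminantCodes

end SecureDSS

/-! ### Memory sharing and the convex hull -/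

namespace SecureDSS

section MemorySharing

variable {F : Type*} [Field F] [Fintype F] {n d ℓ : ℕ}

theorem determinantCode_isTypeISecure {m : ℕ} {x : Fin n → F} (hx : Function.Injective x)
    (hd : d < n) (hℓ : ℓ ≤ d) (hm : 1 ≤ m) (hmd : m ≤ d) :
    (determinantCode d ℓ m x).IsTypeISecure d d ℓ (cornerPoint d ℓ m) := by
  have h := (determinantCode_isLinearSecure hx hd hℓ hm hmd).isTypeISecure
  rwa [card_mSet, card_filePos hℓ] at h

theorem juxtapose_determinantCode_isTypeISecure {J : Type} [Fintype J] [DecidableEq J]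
    {x : Fin n → F} (hx : Function.Injective x) (hd : d < n) (hℓ : ℓ ≤ d) (m : J → ℕ)
    (hm : ∀ j, 1 ≤ m j ∧ m j ≤ d) :
    (LinearCode.juxtapose fun j => determinantCode d ℓ (m j) x).IsTypeISecure d d ℓ
      (∑ j, cornerPoint d ℓ (m j)) := by
  have h := (LinearCode.IsLinearSecure.juxtapose fun j =>
    determinantCode_isLinearSecure hx hd hℓ (hm j).1 (hm j).2).isTypeISecure
  have hp : ∑ j, cornerPoint d ℓ (m j) = ((Fintype.card (Σ j, MSet d (m j)) : ℝ),
      ((∑ j, (d - 1).choose (m j - 1) : ℕ) : ℝ),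
      (Fintype.card (Σ j, FilePos d ℓ (m j)) : ℝ)) := by
    refine Prod.ext ?_ (Prod.ext ?_ ?_)
    · simp [Prod.fst_sum, Fintype.card_sigma, cornerPoint]
    · simp [Prod.fst_sum, Prod.snd_sum, cornerPoint]
    · simp only [Prod.snd_sum, Fintype.card_sigma, Nat.cast_sum, card_filePos hℓ, cornerPoint]
  rw [hp]
  exact h

theorem exists_injective_ne_zero (hq : n < Fintype.card F) :
    ∃ x : Fin n → F, Function.Injective x ∧ ∀ i, x i ≠ 0 := by
  classical
  have hcard : Fintype.card (Fin n) ≤ Fintype.card {y : F // y ≠ 0} := by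
    rw [Fintype.card_fin, Fintype.card_subtype_compl, Fintype.card_subtype_eq]
    omega
  obtain ⟨e⟩ := Function.Embedding.nonempty_of_card_le hcard
  exact ⟨fun i => e i, Subtype.val_injective.comp e.injective, fun i => (e i).2⟩

theorem floor_mul_mul_le {w a : ℝ} (hw : 0 ≤ w) (ha : 0 ≤ a) (T : ℕ) :
    (⌊(T : ℝ) * w⌋₊ : ℝ) * a ≤ T * (w * a) := by
  rw [← mul_assoc]
  exact mul_le_mul_of_nonneg_right (Nat.floor_le (by positivity)) ha

/-- The points of the convex hull are approximated by memory sharing in proportion to the weights,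
rounded down. -/
theorem achievable_of_mem_convexHull (hd : d < n) (hℓ : ℓ ≤ d) (hq : n < Fintype.card F)
    {p : ℝ × ℝ × ℝ} (hp : p ∈ convexHull ℝ (cornerPoint d ℓ '' Set.Icc 1 d)) :
    Achievable F n d d ℓ p := by
  classical
  obtain ⟨ι, _, w, z, hw, -, hz, rfl⟩ := mem_convexHull_iff_exists_fintype.1 hp
  choose m hm hmz using hz
  obtain rfl : z = fun i => cornerPoint d ℓ (m i) := funext fun i => (hmz i).symm
  obtain ⟨x, hx, -⟩ := exists_injective_ne_zero hq
  intro ε hε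
  have hF : ∀ i, 0 ≤ (cornerPoint d ℓ (m i)).2.2 := fun i => by
    rw [cornerPoint, ← card_filePos hℓ]
    exact Nat.cast_nonneg _
  -- Rounding `T * w i` down loses less than one copy of each code, so the total loss of file size
  -- is at most the sum of the file sizes, which this `T` keeps below `T * ε`.
  obtain ⟨T, hT⟩ := exists_nat_gt ((∑ i, (cornerPoint d ℓ (m i)).2.2) / ε)
  have hT0 : 0 < T := by
    have : (0 : ℝ) < T :=
      (div_nonneg (Finset.sum_nonneg fun i _ => hF i) hε.le).trans_lt hT
    exact_mod_cast this
  rw [div_lt_iff₀ hε] at hT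
  have hTε : 0 ≤ (T : ℝ) * ε := by positivity
  let c : ι → ℕ := fun i => ⌊(T : ℝ) * w i⌋₊
  have hsum : ∑ j : Σ i, Fin (c i), cornerPoint d ℓ (m j.1) =
      ∑ i, (c i : ℝ) • cornerPoint d ℓ (m i) := by
    rw [Fintype.sum_sigma]
    simp [← Nat.cast_smul_eq_nsmul ℝ]
  have hC := juxtapose_determinantCode_isTypeISecure hx hd hℓ
    (fun j : Σ i, Fin (c i) => m j.1) fun j => hm j.1
  rw [hsum] at hC
  refine ⟨T, hT0, _, _, _, _, inferInstance, inferInstance, inferInstance, inferInstance,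
    inferInstance, inferInstance, inferInstance, inferInstance, _,
    (∑ i, (c i : ℝ) • cornerPoint d ℓ (m i)).1, (∑ i, (c i : ℝ) • cornerPoint d ℓ (m i)).2.1,
    (∑ i, (c i : ℝ) • cornerPoint d ℓ (m i)).2.2, hC, ?_, ?_, ?_⟩
  · simp only [Prod.fst_sum, Prod.smul_fst, smul_eq_mul, mul_add, Finset.mul_sum]
    refine (Finset.sum_le_sum fun i _ => floor_mul_mul_le (hw i) ?_ T).trans
      (le_add_of_nonneg_right hTε)
    exact Nat.cast_nonneg _
  · simp only [Prod.fst_sum, Prod.snd_sum, Prod.smul_fst, Prod.smul_snd, smul_eq_mul, mul_add,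
      Finset.mul_sum]
    refine (Finset.sum_le_sum fun i _ => floor_mul_mul_le (hw i) ?_ T).trans
      (le_add_of_nonneg_right hTε)
    exact Nat.cast_nonneg _
  · simp only [Prod.snd_sum, Prod.smul_snd, smul_eq_mul, mul_sub, Finset.mul_sum]
    have h : ∀ i, (T : ℝ) * (w i * (cornerPoint d ℓ (m i)).2.2) ≤
        (c i : ℝ) * (cornerPoint d ℓ (m i)).2.2 + (cornerPoint d ℓ (m i)).2.2 := fun i => by
      rw [← mul_assoc, ← add_one_mul]
      exact mul_le_mul_of_nonneg_right (Nat.lt_floor_add_one _).le (hF i)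
    have h' := Finset.sum_le_sum fun i (_ : i ∈ Finset.univ) => h i
    rw [Finset.sum_add_distrib] at h'
    linarith

end MemorySharing

end SecureDSS

theorem theorem1 (n d ℓ : ℕ) (hd : d < n) (hℓ : ℓ ≤ d) (F : Type*) [Field F] [Fintype F]
    (hq : n < Fintype.card F) :
    -- evaluation points exist, and every choice of them yields the codes described next
    (∃ x : Fin n → F, Function.Injective x ∧ ∀ i, x i ≠ 0) ∧
    (∀ x : Fin n → F, Function.Injective x → (∀ i, x i ≠ 0) →
      -- the explicit code of each mode
      (∀ m : ℕ, 1 ≤ m → m ≤ d →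
        (SecureDSS.determinantCode d ℓ m x).IsTypeISecure d d ℓ (SecureDSS.cornerPoint d ℓ m) ∧
        -- each helper only has to send `(d - 1).choose (m - 1)` symbols
        (∀ f : Fin n, (SecureDSS.repairEncoder d m x f).rank = (d - 1).choose (m - 1)) ∧
        -- recovery of the message matrix from any `d` nodes by inverting a `d × d` matrix
        (∀ (e : Fin d ↪ Fin n) ω,
          SecureDSS.decodeRows d x e
              (fun a => (SecureDSS.determinantCode d ℓ m x).content (e a) ω) =
            SecureDSS.messageMatrix F d ℓ m ω) ∧
        -- repair of any node from any `d` other nodes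
        (∀ (f : Fin n) (e : Fin d ↪ Fin n), (∀ a, e a ≠ f) → ∀ ω,
          SecureDSS.decodeNode d m x e
              (fun a => (SecureDSS.determinantCode d ℓ m x).repairData (e a) f
                ((SecureDSS.determinantCode d ℓ m x).content (e a) ω)) =
            (SecureDSS.determinantCode d ℓ m x).content f ω)) ∧
      -- memory sharing: `c r` copies of the code of each mode `r + 1` used side by side
      (∀ c : Fin d → ℕ,
        (SecureDSS.LinearCode.juxtapose fun j : Σ r : Fin d, Fin (c r) =>
            SecureDSS.determinantCode d ℓ ((j.1 : ℕ) + 1) x).IsTypeISecure d d ℓ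
          (∑ r : Fin d, (c r : ℝ) • SecureDSS.cornerPoint d ℓ ((r : ℕ) + 1)))) ∧
    -- all tuples in the convex hull are achievable over `F`
    (∀ p ∈ convexHull ℝ (SecureDSS.cornerPoint d ℓ '' Set.Icc 1 d),
      SecureDSS.Achievable F n d d ℓ p) := by
  refine ⟨SecureDSS.exists_injective_ne_zero hq, fun x hx _ => ⟨fun m hm hmd => ⟨?_, ?_, ?_, ?_⟩,
    fun c => ?_⟩, fun p hp => SecureDSS.achievable_of_mem_convexHull hd hℓ hq hp⟩
  · exact SecureDSS.determinantCode_isTypeISecure hx hd hℓ hm hmd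
  · exact SecureDSS.rank_repairEncoder hm hmd x
  · exact SecureDSS.determinantCode_data_recovery hx
  · exact fun f e _ => SecureDSS.determinantCode_repair hm hx f e
  · have h := SecureDSS.juxtapose_determinantCode_isTypeISecure hx hd hℓ
      (fun j : Σ r : Fin d, Fin (c r) => (j.1 : ℕ) + 1) fun j => ⟨by omega, j.1.2⟩
    rw [Fintype.sum_sigma] at h
    simpa only [Finset.sum_const, Finset.card_univ, Fintype.card_fin,
      ← Nat.cast_smul_eq_nsmul ℝ] using h
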